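/- Let $d\in\mathbb N$. For a polynomial $Q(z)=\sum_\alpha c_\alpha z^\alpha\in\mathbb C[z_1,\dots,z_d]$ write $Q^*(z)=\sum_\alpha\overline{c_\alpha}z^\alpha$, $Q(D)=\sum_\alpha c_\alpha\,\partial_{z_1}^{\alpha_1}\cdots\partial_{z_d}^{\alpha_d}$, and $\|Q\|_a=\bigl(\sum_\alpha \alpha!\,|c_\alpha|^2\bigr)^{1/2}$ (the apolar norm). The order of an entire function $\varphi:\mathbb C^d\to\mathbb C$ is $\limsup_{r\to\infty}\frac{\log\log M(\varphi,r)}{\log r}$, where $M(\varphi,r)=\sup_{|z|=r}|\varphi(z)|$ and $|z|$ is the Euclidean norm (constant functions have order $0$). Let $k\ge 2$ and $0\le\beta_1\le\beta_2\le k-1$, and let $P\in\mathbb C[z_1,\dots,z_d]$ be a polynomial of degree $k$ with expansion $P=P_{\beta_1}+\cdots+P_{\beta_2}+P_k$ into homogeneous components ($P_j$ being homogeneous of degree $j$), where $P_{\beta_1}\ne0$, $P_{\beta_2}\ne 0$ and possibly $\beta_1=\beta_2$. Suppose that there are real constants $0\le\tau\le k-1$ and $C>0$ such that $$\|P_k g_m\|_a\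 \ge\ C\,(m+1)^{\tau/2}\,\|g_m\|_a$$ for all integers $m\ge0$ and all homogeneous polynomials $g_m$ of degree $m$. Put $$b=\frac{2(k-\beta_2)}{k-\tau}\ \text{ if }\beta_2\ge\tau,\qquad b=\frac{2(k-\beta_1)}{k+\beta_2-\beta_1-\tau}\ \text{ if }\beta_2<\tau .$$ If $\varphi:\mathbb C^d\to\mathbb C$ is an entire function of order $\rho<b$ with $P_k^*(D)(P\varphi)=0$, then $\varphi=0$. Consequently, the Fischer operator $\varphi\mapsto P_k^*(D)(P\varphi)$ is injective on the set of entire functions of order less than $b$, and Fischer decompositions are unique: if $f=Pq_1+r_1=Pq_2+r_2$ with $q_1,q_2,r_1,r_2$ entire, $q_1,q_2$ of order less than $b$, and $P_k^*(D)r_1=P_k^*(D)r_2=0$, then $q_1=q_2$ and $r_1=r_2$. -/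

import Mathlib

noncomputable section

namespace FischerUniqueness

/-- Complex Euclidean space `ℂ^d`, with the norm `|z| = √(|z₁|² + ⋯ + |z_d|²)`. -/
abbrev Cd (d : ℕ) : Type := EuclideanSpace ℂ (Fin d)

/-- The value `P(z)` of a polynomial at a point of `ℂ^d`. -/
def evalAt {d : ℕ} (P : MvPolynomial (Fin d) ℂ) (z : Cd d) : ℂ :=
  MvPolynomial.eval (fun i => z i) P

/-- `P^*`: the polynomial whose coefficients are the complex conjugates of those of `P`. -/
def conjPoly {d : ℕ} (P : MvPolynomial (Fin d) ℂ) : MvPolynomial (Fin d) ℂ :=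
  MvPolynomial.map (starRingEnd ℂ) P

/-- The complex partial derivative `∂f/∂z_i`. -/
def partialDeriv {d : ℕ} (i : Fin d) (f : Cd d → ℂ) : Cd d → ℂ :=
  fun z => fderiv ℂ f z (EuclideanSpace.single i 1)

/-- The iterated partial derivative `D^α f = ∂₁^{α₁} ⋯ ∂_d^{α_d} f`. -/
def multiDeriv {d : ℕ} (α : Fin d →₀ ℕ) (f : Cd d → ℂ) : Cd d → ℂ :=
  (List.finRange d).foldr (fun i g => (partialDeriv i)^[α i] g) f

/-- The constant coefficient differential operator `Q(D)`, obtained from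
`Q = ∑ c_α z^α` by replacing `z^α` with `D^α`. -/
def diffOp {d : ℕ} (Q : MvPolynomial (Fin d) ℂ) (f : Cd d → ℂ) : Cd d → ℂ :=
  fun z => ∑ α ∈ Q.support, Q.coeff α * multiDeriv α f z

/-- The Fischer operator `F_{QP}(φ) = Q(D)(P φ)`. -/
def fischerOp {d : ℕ} (Q P : MvPolynomial (Fin d) ℂ) (φ : Cd d → ℂ) : Cd d → ℂ :=
  diffOp Q (fun z => evalAt P z * φ z)

/-- The apolar inner product `⟨P, Q⟩_a = ∑_α α! c_α conj(d_α)`. -/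
def apolarInner {d : ℕ} (P Q : MvPolynomial (Fin d) ℂ) : ℂ :=
  ∑ α ∈ P.support, ((∏ i, (α i).factorial : ℕ) : ℂ) * P.coeff α * (starRingEnd ℂ) (Q.coeff α)

/-- The apolar norm `‖P‖_a = √⟨P, P⟩_a`. -/
def apolarNorm {d : ℕ} (P : MvPolynomial (Fin d) ℂ) : ℝ :=
  Real.sqrt (apolarInner P P).re

/-- The maximum modulus `M(f, r) = sup {|f(z)| : |z| = r}`. -/
def maxModulus {d : ℕ} (f : Cd d → ℂ) (r : ℝ) : ℝ :=
  sSup ((fun z => ‖f z‖) '' Metric.sphere (0 : Cd d) r)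

/-- The order `limsup_{r → ∞} log log M(f, r) / log r` of an entire function, an extended real
number. For a constant function, where `log log M` need not make sense, the conventions for
`Real.log` give the usual value `0`. -/
def entireOrder {d : ℕ} (f : Cd d → ℂ) : EReal :=
  Filter.limsup
    (fun r : ℝ => ((Real.log (Real.log (maxModulus f r)) / Real.log r : ℝ) : EReal))
    Filter.atTop

/-- The bound on the order: `2(k-β₂)/(k-τ)` if `β₂ ≥ τ`, and
`2(k-β₁)/(k+β₂-β₁-τ)` if `β₂ < τ`. -/
def orderBound (k β₁ β₂ : ℕ) (τ : ℝ) : ℝ :=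
  if τ ≤ (β₂ : ℝ) then 2 * ((k : ℝ) - β₂) / ((k : ℝ) - τ)
  else 2 * ((k : ℝ) - β₁) / ((k : ℝ) + β₂ - β₁ - τ)

/-- The entire functions on `ℂ^d` of order less than `b`. -/
def entireOfOrderLT (d : ℕ) (b : ℝ) : Set (Cd d → ℂ) :=
  {φ | Differentiable ℂ φ ∧ entireOrder φ < (b : EReal)}

end FischerUniqueness

end

/-!
Write `f_n` for the degree `n` part of the Taylor series of a solution `φ`. The operator `P_k^*(D)`
is adjoint to multiplication by `P_k` for the apolar inner product, so `P_k^*(D)(P φ) = 0` says that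
the degree `n + k` part of `P φ`, namely `P_k f_n + ∑ P_j f_{n+k-j}`, is orthogonal to
`P_k f_n`. Hence `‖P_k f_n‖ ≤ ∑ ‖P_j f_{n+k-j}‖`. The assumed lower bound on the left and the
elementary bound `‖P_j g‖ ≲ m^{j/2} ‖g‖` for `g` of degree `m` on the right give
`‖f_n‖ ≲ ∑ (n + 1)^{(j-τ)/2} ‖f_{n+k-j}‖`, and `b` is chosen so that
`(j - τ)/2 ≤ (1/b - 1/2)(k - j)` for all occurring `j`. After multiplication by `n!^{1/b-1/2}` the
recursion has constant coefficients and positive shifts, so it has no nonzero nonnegative solution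
that decays faster than every geometric sequence. But Cauchy's estimates for a function of order
less than `ρ < b` yield `‖f_n‖ ≤ A B^n n!^{1/2-1/ρ}`, which is such a decay.
-/

noncomputable section

namespace FischerUniqueness

open Metric MvPolynomial

section SeveralComplexVariables

variable {E F : Type*} [NormedAddCommGroup E] [NormedSpace ℂ E] [NormedAddCommGroup F]
  [NormedSpace ℂ F]

theorem continuous_fderiv_of_differentiable [ProperSpace E] {f : E → F}
    (hf : Differentiable ℂ f) : Continuous (fderiv ℂ f) := by
  refine continuous_iff.2 fun z₀ ε hε => ?_
  obtain ⟨δ, hδ, hfδ⟩ := uniformContinuousOn_iff.1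
    ((isCompact_closedBall z₀ 2).uniformContinuousOn_of_continuous hf.continuous.continuousOn)
    (ε / 4) (by positivity)
  refine ⟨min δ 1, by positivity, fun z hz => ?_⟩
  obtain ⟨hzδ, hz1⟩ := lt_min_iff.1 hz
  -- Cauchy's estimate for `w ↦ f (w + (z - z₀)) - f w`, which is small on the unit ball at `z₀`.
  set g : E → F := fun w => f (w + (z - z₀)) - f w
  have hg : Differentiable ℂ g := by fun_prop
  have hg_small : ∀ w ∈ ball z₀ 1, ‖g w‖ ≤ ε / 4 := fun w hw => by
    have hshift : dist (w + (z - z₀)) w = dist z z₀ := by simp [dist_eq_norm]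
    rw [← dist_eq_norm]
    rw [mem_ball] at hw
    refine (hfδ _ ?_ _ ?_ (hshift.trans_lt hzδ)).le <;> rw [mem_closedBall]
    · linarith [dist_triangle (w + (z - z₀)) w z₀]
    · linarith
  have hmaps : Set.MapsTo g (ball z₀ 1) (closedBall (g z₀) (ε / 2)) := fun w hw => by
    rw [mem_closedBall, dist_eq_norm]
    linarith [norm_sub_le (g w) (g z₀), hg_small w hw, hg_small z₀ (mem_ball_self one_pos)]
  have hderiv : fderiv ℂ g z₀ = fderiv ℂ f z - fderiv ℂ f z₀ := by
    rw [fderiv_fun_sub (by fun_prop) hf.differentiableAt, fderiv_comp_add_right,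
      add_sub_cancel]
  rw [dist_eq_norm, ← hderiv]
  calc ‖fderiv ℂ g z₀‖ ≤ ε / 2 / 1 :=
        Complex.norm_fderiv_le_div_of_mapsTo_ball hg.differentiableOn hmaps one_pos
    _ < ε := by linarith

theorem differentiable_intervalIntegral {𝕜 H G : Type*} [RCLike 𝕜] [NormedAddCommGroup H]
    [NormedSpace 𝕜 H] [ProperSpace H] [NormedAddCommGroup G] [NormedSpace ℝ G] [NormedSpace 𝕜 G]
    {g : H → ℝ → G} {g' : H → ℝ → H →L[𝕜] G} (a b : ℝ)
    (hg : ∀ x, Continuous (g x)) (hg' : Continuous (Function.uncurry g'))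
    (h : ∀ x t, HasFDerivAt (g · t) (g' x t) x) :
    Differentiable 𝕜 fun x => ∫ t in a..b, g x t := by
  intro x₀
  obtain ⟨B, hB⟩ := ((isCompact_closedBall x₀ 1).prod
    (isCompact_uIcc (a := a) (b := b))).exists_bound_of_continuousOn hg'.continuousOn
  refine (intervalIntegral.hasFDerivAt_integral_of_dominated_of_fderiv_le (bound := fun _ => B)
    (ball_mem_nhds x₀ one_pos) (.of_forall fun x => (hg x).aestronglyMeasurable)
    ((hg x₀).intervalIntegrable a b)
    (hg'.comp (Continuous.prodMk_right x₀)).aestronglyMeasurable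
    (.of_forall fun t ht x hx => hB (x, t) ⟨ball_subset_closedBall hx, ?_⟩)
    intervalIntegrable_const (.of_forall fun t _ x _ => h x t)).differentiableAt
  exact Set.uIoc_subset_uIcc ht

theorem fderiv_apply_eq_circleIntegral [CompleteSpace F] {f : E → F} (hf : Differentiable ℂ f)
    (v z : E) : fderiv ℂ f z v =
      (2 * Real.pi * Complex.I)⁻¹ • ∮ t in C(0, 1), (1 / t ^ 2) • f (z + t • v) := by
  have hderiv : deriv (fun t : ℂ => f (z + t • v)) 0 = fderiv ℂ f z v :=
    (hf z).lineDeriv_eq_fderiv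
  have hdiff : Differentiable ℂ fun t : ℂ => f (z + t • v) := by fun_prop
  have h := (hdiff.differentiableOn (s := closedBall 0 1)).deriv_eq_smul_circleIntegral one_pos
  simp only [hderiv, sub_zero] at h
  rw [h, inv_smul_smul₀ Complex.two_pi_I_ne_zero]

theorem differentiable_fderiv_apply [ProperSpace E] [CompleteSpace F] {f : E → F}
    (hf : Differentiable ℂ f) (v : E) : Differentiable ℂ fun z => fderiv ℂ f z v := by
  simp only [fderiv_apply_eq_circleIntegral hf v, circleIntegral]
  have hfderiv := continuous_fderiv_of_differentiable hf
  refine (differentiable_intervalIntegral (g' := fun z θ => deriv (circleMap 0 1) θ •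
    (1 / circleMap 0 1 θ ^ 2) • fderiv ℂ f (z + circleMap 0 1 θ • v)) _ _
    (fun z => ?_) ?_ fun z θ => ?_).const_smul _
  · have := hf.continuous
    simp only [deriv_circleMap]
    fun_prop (disch := simp)
  · simp only [deriv_circleMap, Function.uncurry_def]
    fun_prop (disch := simp)
  · have hshift : HasFDerivAt (fun w => f (w + circleMap 0 1 θ • v))
        (fderiv ℂ f (z + circleMap 0 1 θ • v)) z :=
      (hasFDerivAt_comp_add_right _).2 (hf _).hasFDerivAt
    exact (hshift.const_smul _).const_smul _

theorem contDiff_of_differentiable [FiniteDimensional ℂ E] [CompleteSpace F] {f : E → F}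
    (hf : Differentiable ℂ f) (n : ℕ) : ContDiff ℂ n f := by
  have := FiniteDimensional.proper ℂ E
  induction n generalizing f with
  | zero => exact contDiff_zero.2 hf.continuous
  | succ n ih =>
    exact contDiff_succ_iff_fderiv_apply.2
      ⟨hf, by simp, fun v => ih (differentiable_fderiv_apply hf v)⟩

theorem fderiv_fderiv_apply_comm [FiniteDimensional ℂ E] [CompleteSpace F] {f : E → F}
    (hf : Differentiable ℂ f) (u v z : E) :
    fderiv ℂ (fun w => fderiv ℂ f w v) z u = fderiv ℂ (fun w => fderiv ℂ f w u) z v := by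
  have hf₂ : ContDiff ℂ 2 f := contDiff_of_differentiable hf 2
  have hdiff : DifferentiableAt ℂ (fderiv ℂ f) z :=
    (hf₂.fderiv_right (m := 1) le_rfl).differentiable one_ne_zero z
  have hsymm : IsSymmSndFDerivAt ℂ f z := hf₂.contDiffAt.isSymmSndFDerivAt (by simp)
  simpa [fderiv_clm_apply hdiff (differentiableAt_const _)] using hsymm u v

end SeveralComplexVariables

section ShiftRecursions

theorem rpow_le_rpow_abs_mul_rpow {x y D : ℝ} (hx : 0 < x) (hxy : x ≤ y) (hyx : y ≤ D * x)
    (c : ℝ) : x ^ c ≤ D ^ |c| * y ^ c := by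
  have hD : 1 ≤ D := le_of_mul_le_mul_right (by linarith) hx
  rcases le_or_gt 0 c with hc | hc
  · calc x ^ c ≤ 1 * y ^ c := by rw [one_mul]; gcongr
      _ ≤ D ^ |c| * y ^ c := by
        have := Real.rpow_nonneg (hx.le.trans hxy) c
        gcongr
        exact Real.one_le_rpow hD (abs_nonneg c)
  · calc x ^ c = D ^ |c| * (D * x) ^ c := by
          rw [Real.mul_rpow (by positivity) hx.le, ← mul_assoc, abs_of_neg hc,
            ← Real.rpow_add (by positivity), neg_add_cancel, Real.rpow_zero, one_mul]
      _ ≤ D ^ |c| * y ^ c := mul_le_mul_of_nonneg_left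
          (Real.rpow_le_rpow_of_nonpos (hx.trans_le hxy) hyx hc.le) (by positivity)

theorem factorial_add_le (n s : ℕ) :
    (n + s).factorial ≤ (s + 1) ^ s * (n.factorial * (n + 1) ^ s) :=
  calc (n + s).factorial = n.factorial * (n + 1).ascFactorial s :=
        (Nat.factorial_mul_ascFactorial n s).symm
    _ ≤ n.factorial * ((s + 1) * (n + 1)) ^ s := by
        gcongr
        exact (Nat.ascFactorial_le_pow_add n s).trans (Nat.pow_le_pow_left (by nlinarith) s)
    _ = (s + 1) ^ s * (n.factorial * (n + 1) ^ s) := by rw [mul_pow]; ring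

theorem rpow_mul_factorial_rpow_le (n s : ℕ) (c : ℝ) :
    ((n : ℝ) + 1) ^ (c * s) * (n.factorial : ℝ) ^ c ≤
      (((s : ℝ) + 1) ^ s) ^ |c| * ((n + s).factorial : ℝ) ^ c := by
  have hle : (n.factorial : ℝ) * ((n : ℝ) + 1) ^ s ≤ (n + s).factorial := by
    exact_mod_cast Nat.factorial_mul_pow_le_factorial
  have hge : ((n + s).factorial : ℝ) ≤
      ((s : ℝ) + 1) ^ s * (n.factorial * ((n : ℝ) + 1) ^ s) := by
    exact_mod_cast factorial_add_le n s
  calc ((n : ℝ) + 1) ^ (c * s) * (n.factorial : ℝ) ^ c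
      = (n.factorial * ((n : ℝ) + 1) ^ s) ^ c := by
        rw [Real.mul_rpow (by positivity) (by positivity), mul_comm, mul_comm c,
          Real.rpow_natCast_mul (by positivity)]
    _ ≤ _ := rpow_le_rpow_abs_mul_rpow (by positivity) hle hge c

theorem pow_mul_factorial_rpow_neg_le {B ε : ℝ} (hB : 0 ≤ B) (hε : 0 < ε) (n : ℕ) :
    B ^ n * (n.factorial : ℝ) ^ (-ε) ≤ Real.exp (B ^ (1 / ε)) ^ ε :=
  calc B ^ n * (n.factorial : ℝ) ^ (-ε) = ((B ^ (1 / ε)) ^ n / n.factorial) ^ ε := by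
        rw [Real.div_rpow (by positivity) (by positivity), Real.rpow_neg (by positivity),
          Real.rpow_pow_comm hB, ← Real.rpow_mul (by positivity), one_div_mul_cancel hε.ne',
          Real.rpow_one, div_eq_mul_inv]
    _ ≤ Real.exp (B ^ (1 / ε)) ^ ε := by
        gcongr
        exact Real.pow_div_factorial_le_exp _ (by positivity) n

variable {ι : Type*} {J : Finset ι} {s : ι → ℕ} {K : ι → ℝ}

theorem eq_zero_of_le_sum_shift (hs : ∀ j ∈ J, 0 < s j) (hK : ∀ j ∈ J, 0 ≤ K j) {u : ℕ → ℝ}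
    (hu : ∀ n, 0 ≤ u n) (hrec : ∀ n, u n ≤ ∑ j ∈ J, K j * u (n + s j))
    (hdecay : ∀ L : ℝ, 1 ≤ L → BddAbove (Set.range fun n => u n * L ^ n)) (n : ℕ) : u n = 0 := by
  set L : ℝ := max 1 (2 * ∑ j ∈ J, K j)
  have hL : 1 ≤ L := le_max_left _ _
  have hL0 : 0 < L := by positivity
  set V := ⨆ n, u n * L ^ n
  have hV (n : ℕ) : u n * L ^ n ≤ V := le_ciSup (hdecay L hL) n
  have hV0 : 0 ≤ V := (mul_nonneg (hu 0) (by positivity)).trans (hV 0)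
  have hshift (n : ℕ) {j : ι} (hj : j ∈ J) : u (n + s j) * L ^ n ≤ V / L := by
    have := hu (n + s j)
    rw [le_div_iff₀ hL0, mul_assoc, ← pow_succ]
    refine le_trans ?_ (hV (n + s j))
    gcongr
    exact hs j hj
  have hhalf (n : ℕ) : u n * L ^ n ≤ V / 2 :=
    calc u n * L ^ n ≤ (∑ j ∈ J, K j * u (n + s j)) * L ^ n := by gcongr; exact hrec n
      _ = ∑ j ∈ J, K j * (u (n + s j) * L ^ n) := by simp only [Finset.sum_mul, mul_assoc]
      _ ≤ ∑ j ∈ J, K j * (V / L) :=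
          Finset.sum_le_sum fun j hj => mul_le_mul_of_nonneg_left (hshift n hj) (hK j hj)
      _ = (2 * ∑ j ∈ J, K j) * (V / L / 2) := by rw [← Finset.sum_mul]; ring
      _ ≤ L * (V / L / 2) := by gcongr; exact le_max_right _ _
      _ = V / 2 := by field_simp
  have hV_half : V ≤ V / 2 := ciSup_le hhalf
  have hzero : u n * L ^ n = 0 :=
    le_antisymm ((hV n).trans (by linarith)) (mul_nonneg (hu n) (by positivity))
  exact (mul_eq_zero.1 hzero).resolve_right (by positivity)

theorem eq_zero_of_le_sum_rpow_mul_shift (hs : ∀ j ∈ J, 0 < s j) (hK : ∀ j ∈ J, 0 ≤ K j)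
    {a : ℕ → ℝ} {c ε A B : ℝ} (ha : ∀ n, 0 ≤ a n)
    (hrec : ∀ n, a n ≤ ∑ j ∈ J, K j * ((n : ℝ) + 1) ^ (c * s j) * a (n + s j))
    (hε : 0 < ε) (hA : 0 ≤ A) (hB : 0 ≤ B)
    (hdecay : ∀ n, a n ≤ A * B ^ n * (n.factorial : ℝ) ^ (-c - ε)) (n : ℕ) : a n = 0 := by
  have hfac (n : ℕ) : (0 : ℝ) < n.factorial := by exact_mod_cast n.factorial_pos
  have hweighted : a n * (n.factorial : ℝ) ^ c = 0 := by
    refine eq_zero_of_le_sum_shift (u := fun n => a n * (n.factorial : ℝ) ^ c)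
      (K := fun j => K j * (((s j : ℝ) + 1) ^ s j) ^ |c|) hs
      (fun j hj => mul_nonneg (hK j hj) (by positivity))
      (fun n => mul_nonneg (ha n) (by positivity)) (fun n => ?_) (fun L hL => ?_) n
    · calc a n * (n.factorial : ℝ) ^ c
          ≤ (∑ j ∈ J, K j * ((n : ℝ) + 1) ^ (c * s j) * a (n + s j)) *
            (n.factorial : ℝ) ^ c := by gcongr; exact hrec n
        _ = ∑ j ∈ J, K j * a (n + s j) *
              (((n : ℝ) + 1) ^ (c * s j) * (n.factorial : ℝ) ^ c) := by
            rw [Finset.sum_mul]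
            exact Finset.sum_congr rfl fun j _ => by ring
        _ ≤ ∑ j ∈ J, K j * a (n + s j) *
              ((((s j : ℝ) + 1) ^ s j) ^ |c| * ((n + s j).factorial : ℝ) ^ c) :=
            Finset.sum_le_sum fun j hj => mul_le_mul_of_nonneg_left
              (rpow_mul_factorial_rpow_le n (s j) c) (mul_nonneg (hK j hj) (ha _))
        _ = _ := Finset.sum_congr rfl fun j _ => by ring
    · refine ⟨A * Real.exp ((B * L) ^ (1 / ε)) ^ ε, Set.forall_mem_range.2 fun n => ?_⟩
      calc a n * (n.factorial : ℝ) ^ c * L ^ n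
          ≤ A * B ^ n * (n.factorial : ℝ) ^ (-c - ε) * (n.factorial : ℝ) ^ c * L ^ n := by
            gcongr
            exact hdecay n
        _ = A * ((B * L) ^ n * (n.factorial : ℝ) ^ (-ε)) := by
            rw [show -ε = -c - ε + c by ring, Real.rpow_add (hfac n), mul_pow]
            ring
        _ ≤ A * Real.exp ((B * L) ^ (1 / ε)) ^ ε := by
            gcongr
            exact pow_mul_factorial_rpow_neg_le (by positivity) hε n
  exact (mul_eq_zero.1 hweighted).resolve_right (Real.rpow_pos_of_pos (hfac n) c).ne'

end ShiftRecursions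

variable {d : ℕ}

section ConstantCoefficientOperators

/-- The algebra of entire functions on `ℂ^d`. -/
def entire (d : ℕ) : Subalgebra ℂ (Cd d → ℂ) where
  carrier := {f | Differentiable ℂ f}
  mul_mem' hf hg := hf.mul hg
  add_mem' hf hg := hf.add hg
  algebraMap_mem' c := differentiable_const c

/-- The partial derivative `∂/∂z_i` as a derivation of the algebra of entire functions. -/
def entireDeriv (i : Fin d) : Derivation ℂ (entire d) (entire d) where
  toFun f := ⟨partialDeriv i f,
    differentiable_fderiv_apply f.2 _⟩
  map_add' f g := by
    ext z
    simp [partialDeriv, fderiv_add (f.2 z) (g.2 z)]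
  map_smul' c f := by
    ext z
    simp [partialDeriv, fderiv_const_smul (f.2 z) c]
  map_one_eq_zero' := by
    ext z
    simp [partialDeriv, Pi.one_def]
  leibniz' f g := by
    ext z
    simp [partialDeriv, fderiv_mul (f.2 z) (g.2 z)]

theorem entireDeriv_commute (i j : Fin d) :
    Commute (entireDeriv i : Module.End ℂ (entire d)) (entireDeriv j) := by
  ext f z
  exact fderiv_fderiv_apply_comm f.2 _ _ z

theorem list_prod_map_pow_add_of_commute {ι M : Type*} [Monoid M] {a : ι → M}
    (h : ∀ i j, Commute (a i) (a j)) (L : List ι) (m n : ι → ℕ) :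
    (L.map fun i => a i ^ (m i + n i)).prod =
      (L.map fun i => a i ^ m i).prod * (L.map fun i => a i ^ n i).prod := by
  induction L with
  | nil => simp
  | cons i L ih =>
    have hcomm : Commute (a i ^ n i) (L.map fun i => a i ^ m i).prod := by
      refine Commute.list_prod_right _ _ fun x hx => ?_
      obtain ⟨j, -, rfl⟩ := List.mem_map.1 hx
      exact (h i j).pow_pow _ _
    simp only [List.map_cons, List.prod_cons, ih, pow_add (a i)]
    exact hcomm.mul_mul_mul_comm _ _

/-- The iterated partial derivative `D^α` as an operator on entire functions. -/
def entireMultiDeriv (α : Fin d →₀ ℕ) : Module.End ℂ (entire d) :=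
  ((List.finRange d).map fun i => (entireDeriv i : Module.End ℂ (entire d)) ^ α i).prod

theorem coe_entireMultiDeriv (α : Fin d →₀ ℕ) (f : entire d) :
    (entireMultiDeriv α f : Cd d → ℂ) = multiDeriv α f := by
  have hpow (i : Fin d) (n : ℕ) (g : entire d) :
      (((entireDeriv i : Module.End ℂ (entire d)) ^ n) g : Cd d → ℂ) = (partialDeriv i)^[n] g := by
    rw [Module.End.pow_apply]
    exact Function.Semiconj.iterate_right (f := Subtype.val) (gb := partialDeriv i)
      (fun _ => rfl) n g
  unfold entireMultiDeriv multiDeriv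
  induction List.finRange d with
  | nil => rfl
  | cons i L ih => rw [List.map_cons, List.prod_cons, List.foldr_cons, ← ih, ← hpow]; rfl

theorem entireMultiDeriv_zero : entireMultiDeriv (0 : Fin d →₀ ℕ) = 1 := by
  simp [entireMultiDeriv]

theorem entireMultiDeriv_add (α β : Fin d →₀ ℕ) :
    entireMultiDeriv (α + β) = entireMultiDeriv α * entireMultiDeriv β :=
  list_prod_map_pow_add_of_commute entireDeriv_commute _ α β

theorem entireMultiDeriv_single (i : Fin d) :
    entireMultiDeriv (Finsupp.single i 1) = (entireDeriv i : Module.End ℂ (entire d)) := by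
  rw [entireMultiDeriv, List.prod_map_eq_pow_single i]
  · simp [List.count_eq_one_of_mem (List.nodup_finRange d) (List.mem_finRange i)]
  · intro j hj _
    simp [hj.symm]

/-- The constant coefficient operators `Q(D)` on entire functions: `Q ↦ Q(D)` is an algebra
homomorphism. -/
def entireDiffOp : MvPolynomial (Fin d) ℂ →ₐ[ℂ] Module.End ℂ (entire d) :=
  AddMonoidAlgebra.lift ℂ (Module.End ℂ (entire d)) (Fin d →₀ ℕ)
    { toFun := fun α => entireMultiDeriv α.toAdd
      map_one' := entireMultiDeriv_zero
      map_mul' := fun _ _ => entireMultiDeriv_add _ _ }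

theorem entireDiffOp_apply (Q : MvPolynomial (Fin d) ℂ) (f : entire d) :
    entireDiffOp Q f = ∑ α ∈ Q.support, Q.coeff α • entireMultiDeriv α f := by
  rw [entireDiffOp, AddMonoidAlgebra.lift_apply, Finsupp.sum, LinearMap.sum_apply]
  rfl

theorem coe_entireDiffOp (Q : MvPolynomial (Fin d) ℂ) (f : entire d) :
    (entireDiffOp Q f : Cd d → ℂ) = diffOp Q f := by
  funext z
  simp [entireDiffOp_apply, diffOp, coe_entireMultiDeriv]

theorem entireDiffOp_X (i : Fin d) :
    entireDiffOp (X i) = (entireDeriv i : Module.End ℂ (entire d)) := by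
  ext1 f
  simp [entireDiffOp_apply, support_X, entireMultiDeriv_single]

/-- The inclusion of the polynomials into the entire functions. -/
def polyEntire : MvPolynomial (Fin d) ℂ →ₐ[ℂ] entire d :=
  aeval fun i => ⟨fun z => z i, (EuclideanSpace.proj i : Cd d →L[ℂ] ℂ).differentiable⟩

theorem coe_polyEntire (P : MvPolynomial (Fin d) ℂ) :
    (polyEntire P : Cd d → ℂ) = evalAt P := by
  funext z
  exact DFunLike.congr_fun (comp_aeval (R := ℂ) (B := ℂ) _
    ((Pi.evalAlgHom ℂ (fun _ : Cd d => ℂ) z).comp (entire d).val)) P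

end ConstantCoefficientOperators

section TaylorSeries

/-- The factorial `α! = ∏ i, α_i!` of a multi-index. -/
def multiFactorial {σ : Type*} [Fintype σ] (α : σ →₀ ℕ) : ℕ := ∏ i, (α i).factorial

theorem multiFactorial_pos {σ : Type*} [Fintype σ] (α : σ →₀ ℕ) : 0 < multiFactorial α :=
  Finset.prod_pos fun i _ => (α i).factorial_pos

theorem multiFactorial_add_single {σ : Type*} [Fintype σ] (α : σ →₀ ℕ) (i : σ) :
    multiFactorial (α + Finsupp.single i 1) = (α i + 1) * multiFactorial α := by
  classical
  have hfactor (j : σ) : ((α + Finsupp.single i 1 : σ →₀ ℕ) j).factorial =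
      (if j = i then α i + 1 else 1) * (α j).factorial := by
    by_cases hj : j = i
    · subst hj
      simp [Nat.factorial_succ]
    · simp [hj]
  simp only [multiFactorial, hfactor, Finset.prod_mul_distrib, Finset.prod_ite_eq',
    Finset.mem_univ, if_true]

theorem multiIndex_induction {σ : Type*} {p : (σ →₀ ℕ) → Prop} (zero : p 0)
    (add_single : ∀ α i, p α → p (α + Finsupp.single i 1)) (α : σ →₀ ℕ) : p α := by
  classical
  induction α using Finsupp.induction with
  | zero => exact zero
  | single_add i n β _ _ hβ =>
    rw [add_comm]
    clear * - hβ add_single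
    induction n with
    | zero => simpa using hβ
    | succ n ih => simpa [Finsupp.single_add, add_assoc] using add_single _ i ih

/-- The Taylor series `∑ D^α f(0) / α! z^α` at the origin. -/
def taylorSeries : entire d →ₗ[ℂ] MvPowerSeries (Fin d) ℂ where
  toFun f α := (entireMultiDeriv α f).1 0 / multiFactorial α
  map_add' f g := by
    funext α
    rw [map_add]
    exact add_div ((entireMultiDeriv α f).1 0) _ _
  map_smul' c f := by
    funext α
    rw [map_smul]
    exact mul_div_assoc c ((entireMultiDeriv α f).1 0) _

theorem coeff_taylorSeries (α : Fin d →₀ ℕ) (f : entire d) :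
    MvPowerSeries.coeff α (taylorSeries f) = (entireMultiDeriv α f).1 0 / multiFactorial α := rfl

theorem constantCoeff_taylorSeries (f : entire d) :
    MvPowerSeries.constantCoeff (taylorSeries f) = f.1 0 := by
  rw [← MvPowerSeries.coeff_zero_eq_constantCoeff_apply, coeff_taylorSeries, entireMultiDeriv_zero]
  simp [multiFactorial]

theorem taylorSeries_entireDeriv (i : Fin d) (f : entire d) :
    taylorSeries (entireDeriv i f) = MvPowerSeries.pderiv ℂ i (taylorSeries f) := by
  ext α
  have hi : ((α i : ℂ) + 1) ≠ 0 := by exact_mod_cast (α i).succ_ne_zero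
  rw [MvPowerSeries.coeff_pderiv, coeff_taylorSeries, coeff_taylorSeries, entireMultiDeriv_add,
    entireMultiDeriv_single, multiFactorial_add_single, Nat.cast_mul, Nat.cast_succ,
    div_mul_eq_mul_div, mul_comm _ ((α i : ℂ) + 1), mul_div_mul_left _ _ hi]
  rfl

theorem taylorSeries_one : taylorSeries (1 : entire d) = 1 := by
  refine MvPowerSeries.pderiv.ext (fun i => ?_) (by simp [constantCoeff_taylorSeries])
  rw [← taylorSeries_entireDeriv]
  simp

theorem taylorSeries_mul (f g : entire d) :
    taylorSeries (f * g) = taylorSeries f * taylorSeries g := by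
  ext α
  induction α using multiIndex_induction generalizing f g with
  | zero => simp [constantCoeff_taylorSeries]
  | add_single α i ih =>
    have hi : ((α i : ℂ) + 1) ≠ 0 := by exact_mod_cast (α i).succ_ne_zero
    refine mul_right_cancel₀ hi ?_
    rw [← MvPowerSeries.coeff_pderiv, ← MvPowerSeries.coeff_pderiv, ← taylorSeries_entireDeriv]
    simp only [Derivation.leibniz, smul_eq_mul, map_add, ih, taylorSeries_entireDeriv]

theorem entireDeriv_polyEntire_X (i j : Fin d) :
    entireDeriv i (polyEntire (X j)) = (Pi.single i 1 : Fin d → entire d) j := by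
  ext z
  have h : HasFDerivAt (fun z : Cd d => z j) (EuclideanSpace.proj j : Cd d →L[ℂ] ℂ) z :=
    (EuclideanSpace.proj j : Cd d →L[ℂ] ℂ).hasFDerivAt
  obtain rfl | hij := eq_or_ne i j
  · simp [entireDeriv, partialDeriv, polyEntire, h.fderiv]
  · simp [entireDeriv, partialDeriv, polyEntire, h.fderiv, hij]

theorem taylorSeries_polyEntire (P : MvPolynomial (Fin d) ℂ) :
    taylorSeries (polyEntire P) = P := by
  have hX (j : Fin d) : taylorSeries (polyEntire (X j)) = MvPowerSeries.X j := by
    refine MvPowerSeries.pderiv.ext (fun i => ?_) ?_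
    · rw [MvPowerSeries.pderiv_X, ← taylorSeries_entireDeriv, entireDeriv_polyEntire_X]
      obtain rfl | hij := eq_or_ne i j
      · simp [taylorSeries_one]
      · simp [hij]
    · simp [constantCoeff_taylorSeries, polyEntire]
  let T : entire d →ₐ[ℂ] MvPowerSeries (Fin d) ℂ :=
    AlgHom.ofLinearMap taylorSeries taylorSeries_one taylorSeries_mul
  have h : T.comp polyEntire = coeToMvPowerSeries.algHom ℂ := algHom_ext fun j => by simp [T, hX]
  simpa [T] using DFunLike.congr_fun h P

theorem entireDiffOp_apply_zero (Q : MvPolynomial (Fin d) ℂ) (f : entire d) :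
    (entireDiffOp Q f).1 0 =
      ∑ α ∈ Q.support, multiFactorial α * Q.coeff α * MvPowerSeries.coeff α (taylorSeries f) := by
  have hcoeff (α : Fin d →₀ ℕ) : (entireMultiDeriv α f).1 0 =
      multiFactorial α * MvPowerSeries.coeff α (taylorSeries f) := by
    rw [coeff_taylorSeries, mul_div_cancel₀ _ (Nat.cast_ne_zero.2 (multiFactorial_pos α).ne')]
  simp [entireDiffOp_apply, hcoeff, mul_assoc, mul_left_comm (Q.coeff _)]

theorem iteratedDeriv_line (f : entire d) (z : Cd d) (n : ℕ) (t : ℂ) :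
    iteratedDeriv n (fun t : ℂ => f.1 (t • z)) t =
      (entireDiffOp ((∑ i, C (z i) * X i) ^ n) f).1 (t • z) := by
  induction n generalizing f with
  | zero => simp
  | succ n ih =>
    have hz : z = ∑ i, z i • EuclideanSpace.single i (1 : ℂ) := by
      simpa using ((EuclideanSpace.basisFun (Fin d) ℂ).sum_repr z).symm
    have hderiv : deriv (fun t : ℂ => f.1 (t • z)) =
        fun t => (entireDiffOp (∑ i, C (z i) * X i) f).1 (t • z) := by
      funext t
      calc deriv (fun t : ℂ => f.1 (t • z)) t = fderiv ℂ f.1 (t • z) z :=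
            ((f.2 _).hasFDerivAt.comp_hasDerivAt t
              (by simpa using (hasDerivAt_id t).smul_const z)).deriv
        _ = ∑ i, z i * partialDeriv i f.1 (t • z) := by
            rw [congrArg (fderiv ℂ f.1 (t • z)) hz]
            simp only [map_sum, map_smul, smul_eq_mul, partialDeriv]
        _ = (entireDiffOp (∑ i, C (z i) * X i) f).1 (t • z) := by
            simp [entireDiffOp_X, ← algebraMap_eq, entireDeriv]
    rw [iteratedDeriv_succ', hderiv, ih, pow_succ, map_mul]
    rfl

theorem taylorSeries_injective : Function.Injective (taylorSeries (d := d)) := by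
  refine (injective_iff_map_eq_zero _).2 fun f hf => ?_
  ext z
  have hline : Differentiable ℂ fun t : ℂ => f.1 (t • z) :=
    f.2.comp (differentiable_id.smul_const z)
  have hvanish (n : ℕ) : iteratedDeriv n (fun t : ℂ => f.1 (t • z)) 0 = 0 := by
    rw [iteratedDeriv_line, zero_smul, entireDiffOp_apply_zero, hf]
    simp
  simpa [hvanish] using (Complex.taylorSeries_eq_of_entire' 0 1 hline).symm

end TaylorSeries

section ApolarInnerProduct

variable (p q r : MvPolynomial (Fin d) ℂ)

theorem apolarInner_eq_sum {p : MvPolynomial (Fin d) ℂ} {s : Finset (Fin d →₀ ℕ)}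
    (hs : p.support ⊆ s) : apolarInner p q =
      ∑ α ∈ s, (multiFactorial α : ℂ) * p.coeff α * starRingEnd ℂ (q.coeff α) :=
  Finset.sum_subset hs fun α _ hα => by simp [notMem_support_iff.1 hα]

theorem apolarInner_add_left : apolarInner (p + q) r = apolarInner p r + apolarInner q r := by
  classical
  rw [apolarInner_eq_sum r support_add, apolarInner_eq_sum r Finset.subset_union_left,
    apolarInner_eq_sum r Finset.subset_union_right, ← Finset.sum_add_distrib]
  exact Finset.sum_congr rfl fun α _ => by rw [coeff_add]; ring

theorem apolarInner_smul_left (c : ℂ) : apolarInner (c • p) q = c * apolarInner p q := by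
  rw [apolarInner_eq_sum q (support_smul (a := c) (f := p)), apolarInner_eq_sum q subset_rfl,
    Finset.mul_sum]
  exact Finset.sum_congr rfl fun α _ => by rw [coeff_smul, smul_eq_mul]; ring

theorem conj_apolarInner : starRingEnd ℂ (apolarInner p q) = apolarInner q p := by
  classical
  rw [apolarInner_eq_sum q (Finset.subset_union_left (s₂ := q.support)),
    apolarInner_eq_sum p Finset.subset_union_right, map_sum]
  refine Finset.sum_congr rfl fun α _ => ?_
  simp only [map_mul, map_natCast, Complex.conj_conj]
  ring

theorem apolarInner_self_eq_sum {p : MvPolynomial (Fin d) ℂ} {s : Finset (Fin d →₀ ℕ)}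
    (hs : p.support ⊆ s) : apolarInner p p =
      (∑ α ∈ s, (multiFactorial α : ℝ) * ‖p.coeff α‖ ^ 2 : ℝ) := by
  rw [apolarInner_eq_sum p hs]
  push_cast
  exact Finset.sum_congr rfl fun α _ => by rw [mul_assoc, Complex.mul_conj']

theorem apolarNorm_sq_eq_sum {p : MvPolynomial (Fin d) ℂ} {s : Finset (Fin d →₀ ℕ)}
    (hs : p.support ⊆ s) :
    apolarNorm p ^ 2 = ∑ α ∈ s, (multiFactorial α : ℝ) * ‖p.coeff α‖ ^ 2 := by
  rw [apolarNorm, apolarInner_self_eq_sum hs, Complex.ofReal_re, Real.sq_sqrt (by positivity)]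

/-- The apolar inner product as a semi-inner product in the sense of Mathlib, whose inner products
are conjugate linear in the first variable. -/
abbrev apolarCore : PreInnerProductSpace.Core ℂ (MvPolynomial (Fin d) ℂ) where
  inner p q := apolarInner q p
  conj_inner_symm p q := conj_apolarInner p q
  re_inner_nonneg p := by
    change 0 ≤ (apolarInner p p).re
    rw [apolarInner_self_eq_sum subset_rfl, Complex.ofReal_re]
    positivity
  add_left p q r := by
    change apolarInner r (p + q) = apolarInner r p + apolarInner r q
    rw [← conj_apolarInner, apolarInner_add_left, map_add, conj_apolarInner, conj_apolarInner]
  smul_left p q c := by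
    change apolarInner q (c • p) = starRingEnd ℂ c * apolarInner q p
    rw [← conj_apolarInner, apolarInner_smul_left, map_mul, conj_apolarInner]

theorem norm_apolarInner_le : ‖apolarInner p q‖ ≤ apolarNorm p * apolarNorm q :=
  letI := apolarCore (d := d)
  mul_comm (apolarNorm p) _ ▸ InnerProductSpace.Core.norm_inner_le_norm (𝕜 := ℂ) q p

theorem apolarNorm_nonneg : 0 ≤ apolarNorm p := Real.sqrt_nonneg _

theorem ofReal_apolarNorm_sq : (apolarNorm p ^ 2 : ℂ) = apolarInner p p := by
  rw [apolarInner_self_eq_sum subset_rfl, ← apolarNorm_sq_eq_sum subset_rfl, Complex.ofReal_pow]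

theorem apolarNorm_add_le : apolarNorm (p + q) ≤ apolarNorm p + apolarNorm q :=
  letI := apolarCore (d := d)
  letI := InnerProductSpace.Core.toSeminormedAddCommGroup (𝕜 := ℂ) (F := MvPolynomial (Fin d) ℂ)
  norm_add_le p q

theorem apolarNorm_zero : apolarNorm (0 : MvPolynomial (Fin d) ℂ) = 0 := by
  simp [apolarNorm, apolarInner]

theorem apolarNorm_sum_le {ι : Type*} (s : Finset ι) (p : ι → MvPolynomial (Fin d) ℂ) :
    apolarNorm (∑ i ∈ s, p i) ≤ ∑ i ∈ s, apolarNorm (p i) :=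
  Finset.le_sum_of_subadditive _ apolarNorm_zero.le apolarNorm_add_le s p

theorem apolarNorm_eq_zero_iff {p : MvPolynomial (Fin d) ℂ} : apolarNorm p = 0 ↔ p = 0 := by
  refine ⟨fun h => ?_, fun h => h ▸ apolarNorm_zero⟩
  ext α
  by_contra hα
  have hsum := apolarNorm_sq_eq_sum (p := p) subset_rfl
  rw [h, zero_pow two_ne_zero, eq_comm,
    Finset.sum_eq_zero_iff_of_nonneg fun _ _ => by positivity] at hsum
  have hα' := hsum α (mem_support_iff.2 hα)
  have := multiFactorial_pos α
  have : 0 < ‖coeff α p‖ := norm_pos_iff.2 hα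
  exact (by positivity : 0 < (multiFactorial α : ℝ) * ‖p.coeff α‖ ^ 2).ne' hα'

theorem multiFactorial_add_le {σ : Type*} [Fintype σ] (α γ : σ →₀ ℕ) :
    multiFactorial (γ + α) ≤ (α.degree + γ.degree) ^ γ.degree * multiFactorial α := by
  have hfactor (i : σ) :
      (γ i + α i).factorial ≤ (α.degree + γ.degree) ^ γ i * (α i).factorial := by
    rw [add_comm, ← Nat.factorial_mul_ascFactorial, mul_comm]
    refine Nat.mul_le_mul_right _ ((Nat.ascFactorial_le_pow_add _ _).trans ?_)
    exact Nat.pow_le_pow_left (add_le_add (Finsupp.le_degree i α) (Finsupp.le_degree i γ)) _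
  calc multiFactorial (γ + α) ≤ ∏ i, (α.degree + γ.degree) ^ γ i * (α i).factorial :=
        Finset.prod_le_prod' fun i _ => hfactor i
    _ = (α.degree + γ.degree) ^ γ.degree * multiFactorial α := by
        rw [Finset.prod_mul_distrib, Finset.prod_pow_eq_pow_sum, ← Finsupp.degree_eq_sum]
        rfl

theorem degree_eq_of_isHomogeneous {σ R : Type*} [CommSemiring R] {m : ℕ} {p : MvPolynomial σ R}
    (hp : p.IsHomogeneous m) {α : σ →₀ ℕ} (hα : p.coeff α ≠ 0) : α.degree = m := by
  rw [Finsupp.degree_eq_weight_one]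
  exact hp hα

theorem apolarNorm_monomial_mul_le {m : ℕ} {g : MvPolynomial (Fin d) ℂ} (hg : g.IsHomogeneous m)
    (γ : Fin d →₀ ℕ) (c : ℂ) : apolarNorm (monomial γ c * g) ≤
      ‖c‖ * ((m : ℝ) + γ.degree) ^ ((γ.degree : ℝ) / 2) * apolarNorm g := by
  classical
  have hsupp : (monomial γ c * g).support ⊆ g.support.map (addLeftEmbedding γ) := by
    refine (support_mul _ _).trans fun α hα => ?_
    obtain ⟨β, hβ, α', hα', rfl⟩ := Finset.mem_add.1 hα
    obtain rfl := Finset.mem_singleton.1 (support_monomial_subset hβ)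
    exact Finset.mem_map.2 ⟨α', hα', rfl⟩
  have hpow : (((m : ℝ) + γ.degree) ^ ((γ.degree : ℝ) / 2)) ^ 2 =
      ((m : ℝ) + γ.degree) ^ γ.degree := by
    rw [← Real.rpow_mul_natCast (by positivity), Nat.cast_two, div_mul_cancel₀ _ two_ne_zero,
      Real.rpow_natCast]
  have hfactorial (α) (hα : α ∈ g.support) : (multiFactorial (γ + α) : ℝ) ≤
      ((m : ℝ) + γ.degree) ^ γ.degree * multiFactorial α := by
    rw [← degree_eq_of_isHomogeneous hg (mem_support_iff.1 hα)]
    exact_mod_cast multiFactorial_add_le α γ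
  have := apolarNorm_nonneg g
  refine (sq_le_sq₀ (apolarNorm_nonneg _) (by positivity)).1 ?_
  rw [mul_pow, mul_pow, hpow, apolarNorm_sq_eq_sum hsupp, apolarNorm_sq_eq_sum subset_rfl,
    Finset.sum_map, Finset.mul_sum]
  refine Finset.sum_le_sum fun α hα => ?_
  rw [addLeftEmbedding_apply, coeff_monomial_mul, norm_mul, mul_pow]
  calc (multiFactorial (γ + α) : ℝ) * (‖c‖ ^ 2 * ‖g.coeff α‖ ^ 2)
      ≤ (((m : ℝ) + γ.degree) ^ γ.degree * multiFactorial α) * (‖c‖ ^ 2 * ‖g.coeff α‖ ^ 2) := by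
        gcongr
        exact hfactorial α hα
    _ = ‖c‖ ^ 2 * ((m : ℝ) + γ.degree) ^ γ.degree *
          (multiFactorial α * ‖g.coeff α‖ ^ 2) := by ring

theorem apolarNorm_mul_le {j m : ℕ} {p g : MvPolynomial (Fin d) ℂ} (hp : p.IsHomogeneous j)
    (hg : g.IsHomogeneous m) : apolarNorm (p * g) ≤
      (∑ γ ∈ p.support, ‖p.coeff γ‖) * ((m : ℝ) + j) ^ ((j : ℝ) / 2) * apolarNorm g := by
  calc apolarNorm (p * g) = apolarNorm (∑ γ ∈ p.support, monomial γ (p.coeff γ) * g) := by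
        rw [← Finset.sum_mul, ← as_sum p]
    _ ≤ ∑ γ ∈ p.support, apolarNorm (monomial γ (p.coeff γ) * g) := apolarNorm_sum_le _ _
    _ ≤ ∑ γ ∈ p.support, ‖p.coeff γ‖ * ((m : ℝ) + j) ^ ((j : ℝ) / 2) * apolarNorm g := by
        refine Finset.sum_le_sum fun γ hγ => ?_
        rw [← degree_eq_of_isHomogeneous hp (mem_support_iff.1 hγ)]
        exact apolarNorm_monomial_mul_le hg γ _
    _ = (∑ γ ∈ p.support, ‖p.coeff γ‖) * ((m : ℝ) + j) ^ ((j : ℝ) / 2) * apolarNorm g := by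
        rw [Finset.sum_mul, Finset.sum_mul]

end ApolarInnerProduct

section HomogeneousParts

variable {σ R : Type*} [Finite σ] [CommSemiring R]

/-- The homogeneous part of degree `m` of a power series, as a polynomial. -/
def homPart (m : ℕ) : MvPowerSeries σ R →ₗ[R] MvPolynomial σ R :=
  homogeneousComponent m ∘ₗ MvPowerSeries.truncTotal (m + 1)

theorem coeff_homPart (m : ℕ) (F : MvPowerSeries σ R) (α : σ →₀ ℕ) :
    (homPart m F).coeff α = if α.degree = m then MvPowerSeries.coeff α F else 0 := by
  rw [homPart, LinearMap.comp_apply, coeff_homogeneousComponent]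
  refine ite_congr rfl (fun h => ?_) fun _ => rfl
  exact MvPowerSeries.coeff_truncTotal _ (Nat.lt_succ_of_le h.le)

theorem isHomogeneous_homPart (m : ℕ) (F : MvPowerSeries σ R) :
    (homPart m F).IsHomogeneous m :=
  homogeneousComponent_isHomogeneous _ _

theorem homPart_mul {j : ℕ} {p : MvPolynomial σ R} (hp : p.IsHomogeneous j) (m : ℕ)
    (F : MvPowerSeries σ R) :
    homPart (m + j) ((p : MvPowerSeries σ R) * F) = p * homPart m F := by
  classical
  ext α
  rw [coeff_homPart, coeff_mul, MvPowerSeries.coeff_mul, ← boole_mul, Finset.mul_sum]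
  refine Finset.sum_congr rfl fun x hx => ?_
  rw [coeff_coe, coeff_homPart]
  by_cases h0 : p.coeff x.1 = 0
  · simp [h0]
  have hdeg : α.degree = j + x.2.degree := by
    rw [← Finset.HasAntidiagonal.mem_antidiagonal.1 hx, map_add, degree_eq_of_isHomogeneous hp h0]
  simp [hdeg, add_comm j]

theorem eq_zero_of_homPart_eq_zero {F : MvPowerSeries σ R} (h : ∀ m, homPart m F = 0) :
    F = 0 := by
  ext α
  simpa [coeff_homPart] using congrArg (coeff α) (h α.degree)

theorem apolarInner_homPart_taylorSeries (f : entire d) {N : ℕ} {q : MvPolynomial (Fin d) ℂ}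
    (hq : q.IsHomogeneous N) :
    apolarInner (homPart N (taylorSeries f)) q = (entireDiffOp (conjPoly q) f).1 0 := by
  classical
  have hsupp : (conjPoly q).support ⊆ (homPart N (taylorSeries f)).support ∪ q.support :=
    (support_map_subset _ _).trans Finset.subset_union_right
  rw [apolarInner_eq_sum q Finset.subset_union_left, entireDiffOp_apply_zero,
    Finset.sum_subset hsupp fun α _ hα => by simp [notMem_support_iff.1 hα]]
  refine Finset.sum_congr rfl fun α _ => ?_
  rw [conjPoly, coeff_map, coeff_homPart]
  by_cases h0 : q.coeff α = 0
  · simp [h0]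
  · rw [if_pos (degree_eq_of_isHomogeneous hq h0)]
    ring

theorem apolarInner_homPart_taylorSeries_mul_eq_zero {N : ℕ} {f : entire d}
    {p q : MvPolynomial (Fin d) ℂ} (hpq : (p * q).IsHomogeneous N)
    (h : entireDiffOp (conjPoly p) f = 0) :
    apolarInner (homPart N (taylorSeries f)) (p * q) = 0 := by
  have hconj : conjPoly (p * q) = conjPoly q * conjPoly p := by
    rw [conjPoly, map_mul, mul_comm]
    rfl
  rw [apolarInner_homPart_taylorSeries f hpq, hconj, map_mul, Module.End.mul_apply, h, map_zero]
  rfl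

end HomogeneousParts

section CauchyEstimates

theorem norm_fderiv_apply_le {E F : Type*} [NormedAddCommGroup E] [NormedSpace ℂ E]
    [NormedAddCommGroup F] [NormedSpace ℂ F] {f : E → F} (hf : Differentiable ℂ f) {z v : E}
    {r M : ℝ} (hr : 0 < r) (hM : ∀ t : ℂ, ‖t‖ = r → ‖f (z + t • v)‖ ≤ M) :
    ‖fderiv ℂ f z v‖ ≤ M / r := by
  have hline : Differentiable ℂ fun t : ℂ => f (z + t • v) :=
    hf.comp ((differentiable_const z).add (differentiable_id.smul_const v))
  rw [← (hf z).lineDeriv_eq_fderiv]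
  exact Complex.norm_deriv_le_of_forall_mem_sphere_norm_le hr hline.diffContOnCl
    fun t ht => hM t (mem_sphere_zero_iff_norm.1 ht)

theorem norm_entireMultiDeriv_le {α : Fin d →₀ ℕ} {f : entire d} {z : Cd d} {r M : ℝ}
    (hr : 0 < r) (hM : ∀ w ∈ closedBall z (α.degree * r), ‖f.1 w‖ ≤ M) :
    ‖(entireMultiDeriv α f).1 z‖ ≤ M / r ^ α.degree := by
  induction α using multiIndex_induction generalizing f M with
  | zero => simpa [entireMultiDeriv_zero] using hM z (by simp)
  | add_single α i ih =>
    have hderiv : ∀ w ∈ closedBall z (α.degree * r), ‖(entireDeriv i f).1 w‖ ≤ M / r := by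
      refine fun w hw => norm_fderiv_apply_le f.2 hr fun t ht => hM _ ?_
      have hle : ‖w - z + t • EuclideanSpace.single i (1 : ℂ)‖ ≤ ‖w - z‖ + r :=
        (norm_add_le _ _).trans (by simp [norm_smul, ht])
      rw [mem_closedBall_iff_norm] at hw ⊢
      rw [add_sub_right_comm]
      simpa [add_mul] using hle.trans (add_le_add_left hw r)
    rw [entireMultiDeriv_add, entireMultiDeriv_single]
    simpa [div_div, pow_succ'] using ih hderiv

theorem sum_finsuppAntidiag_inv_multiFactorial {σ : Type*} [Fintype σ] [DecidableEq σ] (m : ℕ) :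
    ∑ α ∈ Finset.finsuppAntidiag (Finset.univ : Finset σ) m, (multiFactorial α : ℝ)⁻¹ =
      (Fintype.card σ : ℝ) ^ m / m.factorial := by
  have h := Finset.sum_pow_eq_sum_piAntidiag (Finset.univ : Finset σ) (fun _ => (1 : ℝ)) m
  simp only [Finset.sum_const, Finset.card_univ, nsmul_eq_mul, mul_one, one_pow,
    Finset.prod_const_one] at h
  rw [h, Finset.sum_div]
  refine Finset.sum_nbij (⇑·) (fun α hα => ?_) DFunLike.coe_injective.injOn (fun α hα => ?_)
    fun α hα => ?_
  · simpa using (Finset.mem_finsuppAntidiag.1 hα).1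
  · refine ⟨Finsupp.equivFunOnFinite.symm α, ?_, rfl⟩
    simpa using hα
  · rw [← (Finset.mem_finsuppAntidiag.1 hα).1, ← Nat.multinomial_spec, Nat.cast_mul]
    have := multiFactorial_pos α
    have := Nat.multinomial_pos Finset.univ α
    field_simp
    rfl

theorem apolarNorm_homPart_taylorSeries_le {f : entire d} {m : ℕ} {r M : ℝ} (hr : 0 < r)
    (hM : ∀ z ∈ closedBall (0 : Cd d) (m * r), ‖f.1 z‖ ≤ M) :
    apolarNorm (homPart m (taylorSeries f)) ≤ M / r ^ m * √(d ^ m / m.factorial) := by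
  have hM0 : 0 ≤ M := (norm_nonneg _).trans (hM 0 (mem_closedBall_self (by positivity)))
  have hsupp : (homPart m (taylorSeries f)).support ⊆ Finset.finsuppAntidiag Finset.univ m := by
    refine fun α hα => Finset.mem_finsuppAntidiag.2 ⟨?_, Finset.subset_univ _⟩
    rw [← Finsupp.degree_eq_sum]
    exact degree_eq_of_isHomogeneous (isHomogeneous_homPart m _) (mem_support_iff.1 hα)
  have hterm : ∀ α ∈ Finset.finsuppAntidiag (Finset.univ : Finset (Fin d)) m,
      (multiFactorial α : ℝ) * ‖(homPart m (taylorSeries f)).coeff α‖ ^ 2 ≤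
        (M / r ^ m) ^ 2 * (multiFactorial α : ℝ)⁻¹ := by
    intro α hα
    have hdeg : α.degree = m := by
      rw [Finsupp.degree_eq_sum]
      exact (Finset.mem_finsuppAntidiag.1 hα).1
    subst hdeg
    have hpos : (0 : ℝ) < multiFactorial α := by exact_mod_cast multiFactorial_pos α
    calc (multiFactorial α : ℝ) * ‖(homPart α.degree (taylorSeries f)).coeff α‖ ^ 2
        = ‖(entireMultiDeriv α f).1 0‖ ^ 2 * (multiFactorial α : ℝ)⁻¹ := by
          rw [coeff_homPart, if_pos rfl, coeff_taylorSeries, norm_div, Complex.norm_natCast]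
          field_simp
      _ ≤ _ := by
          gcongr
          exact norm_entireMultiDeriv_le hr hM
  refine le_of_sq_le_sq ?_ (by positivity)
  calc apolarNorm (homPart m (taylorSeries f)) ^ 2
      ≤ ∑ α ∈ Finset.finsuppAntidiag Finset.univ m, (M / r ^ m) ^ 2 * (multiFactorial α : ℝ)⁻¹ := by
        rw [apolarNorm_sq_eq_sum hsupp]
        exact Finset.sum_le_sum hterm
    _ = (M / r ^ m * √(d ^ m / m.factorial)) ^ 2 := by
        rw [← Finset.mul_sum, sum_finsuppAntidiag_inv_multiFactorial, Fintype.card_fin, mul_pow,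
          Real.sq_sqrt (by positivity)]

theorem exp_div_rpow_pow_mul_sqrt_le (c : ℝ) (d m : ℕ) :
    Real.exp (m + 1) / (((m : ℝ) + 1) ^ c) ^ m * √(d ^ m / m.factorial) ≤
      Real.exp (1 + |c|) * (Real.exp (1 + |c|) * √d) ^ m * (m.factorial : ℝ) ^ (-c - 1 / 2) := by
  have hstirling : (m.factorial : ℝ) ^ c ≤
      Real.exp (m + 1) ^ |c| * (((m : ℝ) + 1) ^ m) ^ c := by
    refine rpow_le_rpow_abs_mul_rpow (by positivity) ?_ ?_ c
    · exact_mod_cast m.factorial_le_pow.trans (Nat.pow_le_pow_left m.le_succ m)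
    · rw [← div_le_iff₀ (by positivity)]
      exact Real.pow_div_factorial_le_exp _ (by positivity) m
  have hexp : Real.exp (m + 1) * Real.exp (m + 1) ^ |c| =
      Real.exp (1 + |c|) * Real.exp (1 + |c|) ^ m := by
    rw [← Real.exp_mul, ← Real.exp_add, ← Real.exp_nat_mul, ← Real.exp_add]
    ring_nf
  calc Real.exp (m + 1) / (((m : ℝ) + 1) ^ c) ^ m * √(d ^ m / m.factorial)
      = Real.exp (m + 1) / (((m : ℝ) + 1) ^ m) ^ c *
          (√d ^ m / (m.factorial : ℝ) ^ (1 / 2 : ℝ)) := by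
        rw [Real.rpow_pow_comm (by positivity), Real.sqrt_div (by positivity),
          Real.sqrt_eq_rpow m.factorial, Real.sqrt_eq_rpow, Real.sqrt_eq_rpow,
          Real.rpow_pow_comm (by positivity)]
    _ ≤ Real.exp (m + 1) * Real.exp (m + 1) ^ |c| / (m.factorial : ℝ) ^ c *
          (√d ^ m / (m.factorial : ℝ) ^ (1 / 2 : ℝ)) := by
        gcongr ?_ * _
        rw [div_le_div_iff₀ (by positivity) (by positivity), mul_assoc]
        gcongr
    _ = _ := by
        rw [hexp, Real.rpow_sub (by positivity), Real.rpow_neg (by positivity), mul_pow]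
        ring

theorem exists_apolarNorm_homPart_taylorSeries_le {f : entire d} {ρ : ℝ} (hρ : 0 < ρ)
    (hf : f.1 =O[⊤] fun z => Real.exp (‖z‖ ^ ρ)) :
    ∃ A B : ℝ, 0 ≤ A ∧ 0 ≤ B ∧ ∀ m, apolarNorm (homPart m (taylorSeries f)) ≤
      A * B ^ m * (m.factorial : ℝ) ^ (1 / 2 - 1 / ρ) := by
  obtain ⟨K, hK, hfK⟩ := hf.exists_nonneg
  have hfK (z : Cd d) : ‖f.1 z‖ ≤ K * Real.exp (‖z‖ ^ ρ) := by
    simpa using Asymptotics.isBigOWith_top.1 hfK z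
  set c : ℝ := 1 / ρ - 1 with hc
  refine ⟨K * Real.exp (1 + |c|), Real.exp (1 + |c|) * √d, by positivity, by positivity,
    fun m => ?_⟩
  have hball : ∀ z ∈ closedBall (0 : Cd d) (m * ((m : ℝ) + 1) ^ c),
      ‖f.1 z‖ ≤ K * Real.exp (m + 1) := by
    intro z hz
    refine (hfK z).trans ?_
    gcongr
    calc ‖z‖ ^ ρ ≤ (((m : ℝ) + 1) * ((m : ℝ) + 1) ^ c) ^ ρ := by
          gcongr
          refine (mem_closedBall_zero_iff.1 hz).trans ?_
          gcongr
          linarith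
      _ = m + 1 := by
          rw [← Real.rpow_one_add' (by positivity) (by simp [hc, hρ.ne']),
            ← Real.rpow_mul (by positivity)]
          simp [hc, hρ.ne']
  calc apolarNorm (homPart m (taylorSeries f))
      ≤ K * (Real.exp (m + 1) / (((m : ℝ) + 1) ^ c) ^ m * √(d ^ m / m.factorial)) := by
        rw [← mul_assoc, ← mul_div_assoc]
        exact apolarNorm_homPart_taylorSeries_le (by positivity) hball
    _ ≤ K * (Real.exp (1 + |c|) * (Real.exp (1 + |c|) * √d) ^ m *
          (m.factorial : ℝ) ^ (-c - 1 / 2)) := by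
        exact mul_le_mul_of_nonneg_left (exp_div_rpow_pow_mul_sqrt_le c d m) hK
    _ = _ := by
        rw [show -c - 1 / 2 = 1 / 2 - 1 / ρ by rw [hc]; ring]
        ring

end CauchyEstimates

section HomogeneousRecursion

variable {k : ℕ} {J : Finset ℕ} {p : MvPolynomial (Fin d) ℂ} {q : ℕ → MvPolynomial (Fin d) ℂ}
  {f : entire d}

theorem apolarNorm_le_of_apolarInner_add_eq_zero {r s : MvPolynomial (Fin d) ℂ}
    (h : apolarInner (r + s) s = 0) : apolarNorm s ≤ apolarNorm r := by
  rw [apolarInner_add_left, ← ofReal_apolarNorm_sq] at h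
  have hsq : apolarNorm s * apolarNorm s ≤ apolarNorm r * apolarNorm s :=
    calc apolarNorm s * apolarNorm s = ‖(apolarNorm s ^ 2 : ℂ)‖ := by
          rw [norm_pow, Complex.norm_real, Real.norm_of_nonneg (apolarNorm_nonneg s), sq]
      _ = ‖apolarInner r s‖ := by rw [eq_neg_of_add_eq_zero_left h, norm_neg]
      _ ≤ apolarNorm r * apolarNorm s := norm_apolarInner_le r s
  obtain hs | hs := (apolarNorm_nonneg s).eq_or_lt
  · exact hs ▸ apolarNorm_nonneg r
  · exact le_of_mul_le_mul_right hsq hs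

theorem apolarNorm_mul_homPart_le_sum (hp : p.IsHomogeneous k)
    (hq : ∀ j ∈ J, (q j).IsHomogeneous j) (hJ : ∀ j ∈ J, j ≤ k)
    (h : entireDiffOp (conjPoly p) (polyEntire (∑ j ∈ J, q j + p) * f) = 0) (n : ℕ) :
    apolarNorm (p * homPart n (taylorSeries f)) ≤
      ∑ j ∈ J, apolarNorm (q j * homPart (n + (k - j)) (taylorSeries f)) := by
  have hhom : (p * homPart n (taylorSeries f)).IsHomogeneous (n + k) :=
    add_comm k n ▸ hp.mul (isHomogeneous_homPart n _)
  have hexpand : homPart (n + k) (taylorSeries (polyEntire (∑ j ∈ J, q j + p) * f)) =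
      ∑ j ∈ J, q j * homPart (n + (k - j)) (taylorSeries f) +
        p * homPart n (taylorSeries f) := by
    rw [taylorSeries_mul, taylorSeries_polyEntire, coe_add, add_mul, map_add, homPart_mul hp,
      ← coeToMvPowerSeries.ringHom_apply, map_sum, Finset.sum_mul, map_sum]
    congr 1
    refine Finset.sum_congr rfl fun j hj => ?_
    have hjk := hJ j hj
    rw [← homPart_mul (hq j hj), add_assoc, Nat.sub_add_cancel hjk]
    rfl
  have horth := apolarInner_homPart_taylorSeries_mul_eq_zero hhom h
  rw [hexpand] at horth
  exact (apolarNorm_le_of_apolarInner_add_eq_zero horth).trans (apolarNorm_sum_le _ _)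

theorem apolarNorm_mul_homPart_le_rpow {j n : ℕ} {p : MvPolynomial (Fin d) ℂ}
    (hp : p.IsHomogeneous j) (hj : j < k) (F : MvPowerSeries (Fin d) ℂ) :
    apolarNorm (p * homPart (n + (k - j)) F) ≤
      (∑ γ ∈ p.support, ‖p.coeff γ‖) * (k : ℝ) ^ ((j : ℝ) / 2) * ((n : ℝ) + 1) ^ ((j : ℝ) / 2) *
        apolarNorm (homPart (n + (k - j)) F) := by
  have hdeg : ((n + (k - j) : ℕ) : ℝ) + j ≤ k * ((n : ℝ) + 1) := by
    have : n + (k - j) + j ≤ k * (n + 1) := by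
      rw [add_assoc, Nat.sub_add_cancel hj.le]
      nlinarith
    exact_mod_cast this
  refine (apolarNorm_mul_le hp (isHomogeneous_homPart _ F)).trans ?_
  rw [mul_assoc (∑ γ ∈ p.support, ‖p.coeff γ‖) (_ ^ _) (_ ^ _),
    ← Real.mul_rpow (by positivity) (by positivity)]
  have := apolarNorm_nonneg (homPart (n + (k - j)) F)
  gcongr

theorem eq_zero_of_entireDiffOp_mul_eq_zero (hp : p.IsHomogeneous k)
    (hq : ∀ j ∈ J, (q j).IsHomogeneous j) (hJ : ∀ j ∈ J, j < k) {τ C b ρ : ℝ} (hC : 0 < C)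
    (hlower : ∀ (m : ℕ) (g : MvPolynomial (Fin d) ℂ), g.IsHomogeneous m →
      C * ((m : ℝ) + 1) ^ (τ / 2) * apolarNorm g ≤ apolarNorm (p * g))
    (hb : ∀ j ∈ J, ((j : ℝ) - τ) / 2 ≤ (1 / b - 1 / 2) * (k - j)) (hρ : 0 < ρ) (hρb : ρ < b)
    (hf : f.1 =O[⊤] fun z => Real.exp (‖z‖ ^ ρ))
    (h : entireDiffOp (conjPoly p) (polyEntire (∑ j ∈ J, q j + p) * f) = 0) : f = 0 := by
  obtain ⟨A, B, hA, hB, hdecay⟩ := exists_apolarNorm_homPart_taylorSeries_le hρ hf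
  set K : ℕ → ℝ := fun j => (∑ γ ∈ (q j).support, ‖(q j).coeff γ‖) * (k : ℝ) ^ ((j : ℝ) / 2)
  have hrec (n : ℕ) : apolarNorm (homPart n (taylorSeries f)) ≤
      ∑ j ∈ J, K j / C * ((n : ℝ) + 1) ^ ((1 / b - 1 / 2) * (k - j : ℕ)) *
        apolarNorm (homPart (n + (k - j)) (taylorSeries f)) := by
    have hlow := (hlower n _ (isHomogeneous_homPart n (taylorSeries f))).trans
      (apolarNorm_mul_homPart_le_sum hp hq (fun j hj => (hJ j hj).le) h n)
    rw [← le_div_iff₀' (by positivity), Finset.sum_div] at hlow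
    refine hlow.trans (Finset.sum_le_sum fun j hj => ?_)
    have : 0 ≤ K j := by positivity
    have ha := apolarNorm_nonneg (homPart (n + (k - j)) (taylorSeries f))
    calc apolarNorm (q j * homPart (n + (k - j)) (taylorSeries f)) / (C * ((n : ℝ) + 1) ^ (τ / 2))
        ≤ K j * ((n : ℝ) + 1) ^ ((j : ℝ) / 2) *
            apolarNorm (homPart (n + (k - j)) (taylorSeries f)) /
              (C * ((n : ℝ) + 1) ^ (τ / 2)) := by
          gcongr
          exact apolarNorm_mul_homPart_le_rpow (hq j hj) (hJ j hj) _
      _ = K j / C * ((n : ℝ) + 1) ^ (((j : ℝ) - τ) / 2) *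
            apolarNorm (homPart (n + (k - j)) (taylorSeries f)) := by
          rw [sub_div, Real.rpow_sub (by positivity)]
          field_simp
      _ ≤ _ := by
          rw [Nat.cast_sub (hJ j hj).le]
          gcongr
          · linarith [(n.cast_nonneg : (0 : ℝ) ≤ n)]
          · exact hb j hj
  refine taylorSeries_injective ((eq_zero_of_homPart_eq_zero fun n => ?_).trans (map_zero _).symm)
  refine apolarNorm_eq_zero_iff.1 (eq_zero_of_le_sum_rpow_mul_shift
    (fun j hj => Nat.sub_pos_of_lt (hJ j hj)) (fun j _ => by positivity)
    (fun n => apolarNorm_nonneg _) hrec (ε := 1 / ρ - 1 / b)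
    (sub_pos.2 (one_div_lt_one_div_of_lt hρ hρb)) hA hB (fun n => ?_) n)
  exact (hdecay n).trans_eq (by congr 2; ring)

end HomogeneousRecursion

section OrderOfGrowth

theorem le_exp_rpow_of_log_log_div_log_lt {M r ρ : ℝ} (hr : 1 < r)
    (h : Real.log (Real.log M) / Real.log r < ρ) : M ≤ Real.exp (r ^ ρ) := by
  have hr0 : 0 < r := one_pos.trans hr
  refine (Real.le_exp_log M).trans (Real.exp_le_exp.2 ?_)
  obtain hM | hM := le_or_gt (Real.log M) 0
  · exact hM.trans (by positivity)
  · rw [div_lt_iff₀ (Real.log_pos hr), ← Real.log_rpow hr0] at h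
    exact ((Real.log_lt_log_iff hM (by positivity)).1 h).le

theorem norm_le_maxModulus {φ : Cd d → ℂ} (hφ : Continuous φ) (z : Cd d) :
    ‖φ z‖ ≤ maxModulus φ ‖z‖ :=
  le_csSup ((isCompact_sphere 0 ‖z‖).image hφ.norm).bddAbove ⟨z, by simp, rfl⟩

theorem isBigO_exp_norm_rpow_of_entireOrder_lt {φ : Cd d → ℂ} (hφ : Continuous φ) {ρ : ℝ}
    (h : entireOrder φ < ρ) : φ =O[⊤] fun z => Real.exp (‖z‖ ^ ρ) := by
  obtain ⟨R, hR⟩ := Filter.eventually_atTop.1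
    ((Filter.eventually_lt_of_limsup_lt h).and (Filter.eventually_gt_atTop 1))
  have hfar : φ =O[Filter.principal (closedBall 0 R)ᶜ] fun z => Real.exp (‖z‖ ^ ρ) := by
    refine Asymptotics.isBigO_principal.2 ⟨1, fun z hz => ?_⟩
    have hzR : R < ‖z‖ := by simpa using hz
    obtain ⟨hlog, hz1⟩ := hR ‖z‖ hzR.le
    simpa using (norm_le_maxModulus hφ z).trans
      (le_exp_rpow_of_log_log_div_log_lt hz1 (EReal.coe_lt_coe_iff.1 hlog))
  have hnear : φ =O[Filter.principal (closedBall 0 R)] fun z => Real.exp (‖z‖ ^ ρ) :=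
    (hφ.continuousOn.isBigO_principal (isCompact_closedBall 0 R) (c := (1 : ℝ)) (by simp)).trans
      (Asymptotics.IsBigO.of_norm_le fun z => by
        simpa using Real.rpow_nonneg (norm_nonneg z) ρ)
  simpa using hnear.sup hfar

theorem zero_mem_entireOfOrderLT {b : ℝ} (hb : 0 < b) :
    (0 : Cd d → ℂ) ∈ entireOfOrderLT d b := by
  refine ⟨differentiable_const 0, ?_⟩
  have hmax (r : ℝ) : maxModulus (0 : Cd d → ℂ) r = 0 :=
    le_antisymm (Real.sSup_nonpos (by simp)) (Real.sSup_nonneg (by simp))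
  simpa [entireOrder, hmax] using hb

end OrderOfGrowth

section OrderBound

variable {k β₁ β₂ : ℕ} {τ : ℝ}

theorem orderBound_pos (hβ₁₂ : β₁ ≤ β₂) (hβ₂ : β₂ < k) (hτ : τ < (k : ℝ) + β₂ - β₁) :
    0 < orderBound k β₁ β₂ τ := by
  have : (β₁ : ℝ) ≤ β₂ := by exact_mod_cast hβ₁₂
  have : (β₂ : ℝ) < k := by exact_mod_cast hβ₂
  rw [orderBound]
  split_ifs <;> exact div_pos (by linarith) (by linarith)

theorem half_sub_le_one_div_orderBound_sub_half_mul {j : ℕ} (hj : j ∈ Finset.Icc β₁ β₂)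
    (hβ₂ : β₂ < k) : ((j : ℝ) - τ) / 2 ≤ (1 / orderBound k β₁ β₂ τ - 1 / 2) * (k - j) := by
  obtain ⟨h₁, h₂⟩ := Finset.mem_Icc.1 hj
  have h₁' : (β₁ : ℝ) ≤ j := by exact_mod_cast h₁
  have h₂' : (j : ℝ) ≤ β₂ := by exact_mod_cast h₂
  have hβ₂' : (0 : ℝ) < k - β₂ := sub_pos.2 (by exact_mod_cast hβ₂)
  have hβ₁' : (0 : ℝ) < k - β₁ := by linarith
  rw [orderBound]
  split_ifs with hτ
  · have hexp : 1 / (2 * ((k : ℝ) - β₂) / (k - τ)) - 1 / 2 = (β₂ - τ) / (2 * (k - β₂)) := by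
      rw [one_div_div]
      field_simp
      ring
    rw [hexp, div_mul_eq_mul_div, div_le_div_iff₀ two_pos (by positivity)]
    nlinarith
  · have hexp : 1 / (2 * ((k : ℝ) - β₁) / (k + β₂ - β₁ - τ)) - 1 / 2 =
        (β₂ - τ) / (2 * (k - β₁)) := by
      rw [one_div_div]
      field_simp
      ring
    rw [hexp, div_mul_eq_mul_div, div_le_div_iff₀ two_pos (by positivity)]
    nlinarith

end OrderBound

section FischerOperator

variable {Q P : MvPolynomial (Fin d) ℂ}

theorem coe_entireDiffOp_polyEntire_mul (f : entire d) :
    (entireDiffOp Q (polyEntire P * f) : Cd d → ℂ) = fischerOp Q P f := by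
  rw [coe_entireDiffOp, fischerOp, ← coe_polyEntire]
  rfl

theorem fischerOp_zero : fischerOp Q P 0 = 0 := by
  simpa using (coe_entireDiffOp_polyEntire_mul (Q := Q) (P := P) 0).symm

theorem eq_and_eq_of_injOn_fischerOp {S : Set (Cd d → ℂ)} (hS : ∀ φ ∈ S, Differentiable ℂ φ)
    (hinj : Set.InjOn (fischerOp Q P) S) {q₁ q₂ r₁ r₂ : Cd d → ℂ} (hq₁ : q₁ ∈ S) (hq₂ : q₂ ∈ S)
    (hr₁ : Differentiable ℂ r₁) (hr₂ : Differentiable ℂ r₂)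
    (heq : ∀ z, evalAt P z * q₁ z + r₁ z = evalAt P z * q₂ z + r₂ z)
    (hr : diffOp Q r₁ = diffOp Q r₂) : q₁ = q₂ ∧ r₁ = r₂ := by
  lift q₁ to entire d using hS _ hq₁
  lift q₂ to entire d using hS _ hq₂
  lift r₁ to entire d using hr₁
  lift r₂ to entire d using hr₂
  have hsum : polyEntire P * q₁ + r₁ = polyEntire P * q₂ + r₂ := by
    ext z
    simpa [coe_polyEntire] using heq z
  have hdiff : entireDiffOp Q r₁ = entireDiffOp Q r₂ :=
    Subtype.ext (by rw [coe_entireDiffOp, coe_entireDiffOp, hr])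
  have hfischer := congrArg (entireDiffOp Q) hsum
  rw [map_add, map_add, hdiff, add_left_inj] at hfischer
  have hq : (q₁ : Cd d → ℂ) = q₂ := by
    refine hinj hq₁ hq₂ ?_
    rw [← coe_entireDiffOp_polyEntire_mul, hfischer, coe_entireDiffOp_polyEntire_mul]
  refine ⟨hq, funext fun z => ?_⟩
  simpa [hq] using heq z

theorem injOn_fischerOp {k : ℕ} {J : Finset ℕ} {p : MvPolynomial (Fin d) ℂ}
    {q : ℕ → MvPolynomial (Fin d) ℂ} (hp : p.IsHomogeneous k)
    (hq : ∀ j ∈ J, (q j).IsHomogeneous j) (hJ : ∀ j ∈ J, j < k) {τ C b : ℝ} (hC : 0 < C)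
    (hlower : ∀ (m : ℕ) (g : MvPolynomial (Fin d) ℂ), g.IsHomogeneous m →
      C * ((m : ℝ) + 1) ^ (τ / 2) * apolarNorm g ≤ apolarNorm (p * g))
    (hb₀ : 0 < b) (hb : ∀ j ∈ J, ((j : ℝ) - τ) / 2 ≤ (1 / b - 1 / 2) * (k - j)) :
    Set.InjOn (fischerOp (conjPoly p) (∑ j ∈ J, q j + p)) (entireOfOrderLT d b) := by
  rintro φ ⟨hφ, hφb⟩ ψ ⟨hψ, hψb⟩ h
  obtain ⟨ρ, hρ, hρb⟩ := EReal.lt_iff_exists_real_btwn.1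
    (max_lt (EReal.coe_pos.2 hb₀) (max_lt hφb hψb))
  simp only [max_lt_iff] at hρ
  lift φ to entire d using hφ
  lift ψ to entire d using hψ
  refine congrArg Subtype.val (sub_eq_zero.1 (eq_zero_of_entireDiffOp_mul_eq_zero (f := φ - ψ)
    hp hq hJ hC hlower hb (EReal.coe_pos.1 hρ.1) (EReal.coe_lt_coe_iff.1 hρb) ?_ ?_))
  · exact (isBigO_exp_norm_rpow_of_entireOrder_lt φ.2.continuous hρ.2.1).sub
      (isBigO_exp_norm_rpow_of_entireOrder_lt ψ.2.continuous hρ.2.2)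
  · rw [mul_sub, map_sub, sub_eq_zero]
    refine Subtype.ext ?_
    rw [coe_entireDiffOp_polyEntire_mul, coe_entireDiffOp_polyEntire_mul, h]

end FischerOperator

end FischerUniqueness

end

open FischerUniqueness MvPolynomial in
theorem mainTheorem1_general {d k β₁ β₂ : ℕ} (hβ₁₂ : β₁ ≤ β₂) (hβ₂ : β₂ < k)
    {P : MvPolynomial (Fin d) ℂ}
    (hP : P = (∑ j ∈ Finset.Icc β₁ β₂, homogeneousComponent j P) + homogeneousComponent k P)
    {τ C : ℝ} (hτ : τ < (k : ℝ) + β₂ - β₁) (hC : 0 < C)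
    (hKS : ∀ (m : ℕ) (g : MvPolynomial (Fin d) ℂ), g.IsHomogeneous m →
      C * ((m : ℝ) + 1) ^ (τ / 2) * apolarNorm g ≤ apolarNorm (homogeneousComponent k P * g)) :
    (∀ φ : Cd d → ℂ, Differentiable ℂ φ → entireOrder φ < (orderBound k β₁ β₂ τ : EReal) →
      fischerOp (conjPoly (homogeneousComponent k P)) P φ = 0 → φ = 0) ∧
    Set.InjOn (fischerOp (conjPoly (homogeneousComponent k P)) P)
      (entireOfOrderLT d (orderBound k β₁ β₂ τ)) ∧
    (∀ f q₁ q₂ r₁ r₂ : Cd d → ℂ,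
      q₁ ∈ entireOfOrderLT d (orderBound k β₁ β₂ τ) →
      q₂ ∈ entireOfOrderLT d (orderBound k β₁ β₂ τ) →
      Differentiable ℂ r₁ → Differentiable ℂ r₂ →
      (∀ z, f z = evalAt P z * q₁ z + r₁ z) → (∀ z, f z = evalAt P z * q₂ z + r₂ z) →
      diffOp (conjPoly (homogeneousComponent k P)) r₁ = 0 →
      diffOp (conjPoly (homogeneousComponent k P)) r₂ = 0 → q₁ = q₂ ∧ r₁ = r₂) := by
  have hb := orderBound_pos hβ₁₂ hβ₂ hτ
  have hinj : Set.InjOn (fischerOp (conjPoly (homogeneousComponent k P)) P)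
      (entireOfOrderLT d (orderBound k β₁ β₂ τ)) := by
    have h := injOn_fischerOp (homogeneousComponent_isHomogeneous k P)
      (fun j _ => homogeneousComponent_isHomogeneous j P)
      (fun j hj => (Finset.mem_Icc.1 hj).2.trans_lt hβ₂) hC hKS hb
      (fun j hj => half_sub_le_one_div_orderBound_sub_half_mul hj hβ₂)
    rwa [← hP] at h
  refine ⟨fun φ hφ hord h => ?_, hinj, fun f q₁ q₂ r₁ r₂ hq₁ hq₂ hr₁ hr₂ h₁ h₂ hd₁ hd₂ => ?_⟩
  · exact hinj ⟨hφ, hord⟩ (zero_mem_entireOfOrderLT hb) (h.trans fischerOp_zero.symm)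
  · exact eq_and_eq_of_injOn_fischerOp (fun _ => And.left) hinj hq₁ hq₂ hr₁ hr₂
      (fun z => (h₁ z).symm.trans (h₂ z)) (hd₁.trans hd₂.symm)

theorem mainTheorem1 (d k β₁ β₂ : ℕ) (hk : 2 ≤ k) (hβ₁₂ : β₁ ≤ β₂) (hβ₂ : β₂ ≤ k - 1)
    (P : MvPolynomial (Fin d) ℂ) (hdeg : P.totalDegree = k)
    (hP : P = (∑ j ∈ Finset.Icc β₁ β₂, MvPolynomial.homogeneousComponent j P)
      + MvPolynomial.homogeneousComponent k P)
    (hP₁ : MvPolynomial.homogeneousComponent β₁ P ≠ 0)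
    (hP₂ : MvPolynomial.homogeneousComponent β₂ P ≠ 0)
    (τ C : ℝ) (hτ₀ : 0 ≤ τ) (hτ : τ ≤ (k : ℝ) - 1) (hC : 0 < C)
    (hKS : ∀ (m : ℕ) (g : MvPolynomial (Fin d) ℂ), g.IsHomogeneous m →
      FischerUniqueness.apolarNorm (MvPolynomial.homogeneousComponent k P * g)
        ≥ C * ((m : ℝ) + 1) ^ (τ / 2) * FischerUniqueness.apolarNorm g) :
    -- an entire solution of low order vanishes
    (∀ φ : FischerUniqueness.Cd d → ℂ, Differentiable ℂ φ →
      FischerUniqueness.entireOrder φ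
        < ((FischerUniqueness.orderBound k β₁ β₂ τ : ℝ) : EReal) →
      FischerUniqueness.diffOp
        (FischerUniqueness.conjPoly (MvPolynomial.homogeneousComponent k P))
        (fun z => FischerUniqueness.evalAt P z * φ z) = 0 →
      φ = 0) ∧
    -- the Fischer operator is injective on the entire functions of low order
    Set.InjOn
      (FischerUniqueness.fischerOp
        (FischerUniqueness.conjPoly (MvPolynomial.homogeneousComponent k P)) P)
      (FischerUniqueness.entireOfOrderLT d (FischerUniqueness.orderBound k β₁ β₂ τ)) ∧
    -- Fischer decompositions `f = P q + r` with `q` of low order are unique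
    (∀ f q₁ q₂ r₁ r₂ : FischerUniqueness.Cd d → ℂ,
      q₁ ∈ FischerUniqueness.entireOfOrderLT d (FischerUniqueness.orderBound k β₁ β₂ τ) →
      q₂ ∈ FischerUniqueness.entireOfOrderLT d (FischerUniqueness.orderBound k β₁ β₂ τ) →
      Differentiable ℂ r₁ → Differentiable ℂ r₂ →
      (∀ z, f z = FischerUniqueness.evalAt P z * q₁ z + r₁ z) →
      (∀ z, f z = FischerUniqueness.evalAt P z * q₂ z + r₂ z) →
      FischerUniqueness.diffOp
        (FischerUniqueness.conjPoly (MvPolynomial.homogeneousComponent k P)) r₁ = 0 →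
      FischerUniqueness.diffOp
        (FischerUniqueness.conjPoly (MvPolynomial.homogeneousComponent k P)) r₂ = 0 →
      q₁ = q₂ ∧ r₁ = r₂) := by
  have hβ : (β₁ : ℝ) ≤ β₂ := by exact_mod_cast hβ₁₂
  exact mainTheorem1_general hβ₁₂ (by omega) hP (by linarith) hC hKS
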